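/- **Setting.** Let $F$ be a complete normed field of characteristic $0$ (the trivial norm is allowed). Variables are indexed by a finite set of size $n$. For a series $f$ let $NP(f)=\operatorname{conv}(\operatorname{supp} f)+\mathbb R_{\ge 0}^n$. Its *normal vectors* are the coprime vectors $v\in\mathbb N^n$ that are minimal on $NP(f)$ along a facet. For a vertex $a$ of $NP(f)$, the *vertex cone* is generated by the normal vectors of the facets through $a$. An *exponential matrix* of $f$ at $a$ is a unimodular matrix $M$ over $\mathbb N$ whose columns generate a cone of a unimodular simplicial refinement of the vertex cone (every original generator being used). The substitution $X=Y^{M}$ acts on exponents by $\alpha\mapsto\alpha M$. Let $E$ be a set of columns (the *exceptional* columns) of a rational matrix $Q$. The variable of a row is *consistent* with $(Q,E)$ if, after deletion of this row, the columns in $E$ still have rank $|E|$; otherwise it is *inconsistent*. Relabel the rows so that the $E\times E$ block of $Q$ is non-singular. The *canonical reduction* $N$ of $Q$ keeps the columns in $E$ and replaces the others by unit vectors. The *partial transform* of $f$ at the vertex $a$ is obtained by the substitution $X=Y^{N}$ and division by the monomial $\prod_{i\in E}y_i^{(aN)_i}$; the *proper transform* is its restriction to $y_i=0$, $i\in E$.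 A *reduced branch point* is a zero $s$ of the proper transform with $s_i=0$ for $i\in E$ and $s_i\ne 0$ for $i\notin E$, on a neighbourhood of which the partial transform converges absolutely. *Localization* is the substitution $Y=Z+s$. A reduced branch point is *regular* with respect to a non-exceptional variable if the localized proper transform is not identically zero on the axis of that variable. A *Weierstrass polynomial* in $x$ of height $m$ is $x^m+\sum_{j=2}^m c_jx^{m-j}$ with $c_j$ power series in the other variables and $c_j(0)=0$. The order of a series is the least total degree of its terms; it is the *singularity height* at the branch point. *Latent reductions* of a localized partial transform, relative to some latent primary variables, are: an invertible linear modification of the non-exceptional variables; then a translation $x\mapsto x+g$ of a chosen non-exceptional variable $x$ (the new primary variable), with $g(0)=0$ and $g$ independent of $x$; then multiplication by a unit $v$ (removal of the redundant unit). Here $g$ and $v$ have only terms whose latent primary components vanish. These components are the exponents of the latent primary variables obtained by applying the inverse of the current interim matrix ($T$ or $T'$ below) to the exponent of a monomial. In the resulting function, the part consisting of the terms with vanishing latent primary components is to be a Weierstrass polynomial in $x$ whose height is the order of the localized proper transform. **First step.** Let $w$ be a Weierstrass polynomial in $x_1$ of height $d=\operatorname{ord}w>1$, let $M$ be an exponential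 matrix of $w$ at a vertex, let $E$ be exceptional columns with non-singular $E\times E$ block such that $x_1$ is inconsistent with $(M,E)$ and its row lies in the block, and let $N$ be the canonical reduction of $M$. Write $N=S\cdot T$, where $S$ is invertible and has these columns: the non-exceptional columns of $N$; the exceptional columns of $N$ except one, with the entries in the row of $x_1$ replaced by $0$ (their new variables are the *interim variables* $\zeta$); and the unit vector of $x_1$ (the *latent primary variable* $x_1$). Localize the partial transform at a reduced branch point and perform latent reductions with new primary variable $x'_1$. This gives $f(X')$; let $d'$ be the height, that is, the order of the localized proper transform. **Second step.** Let $M'$ be an exponential matrix of $f(X')$ at a vertex, $E'$ exceptional columns with non-singular $E'\times E'$ block such that $x'_1$ is inconsistent with $(M',E')$ and its row lies in the block, $N'$ the canonical reduction, and $\mathcal Q'=T\cdot N'$ the synthetic matrix. Suppose that $x_1$ and $x'_1$ are both inconsistent with $(\mathcal Q',E')$ (nesting degree two). Write $\mathcal Q'=S'\cdot T'$, where $S'$ is invertible and has these columns: the non-exceptional columns of $\mathcal Q'$; the exceptional columns of $\mathcal Q'$ except two, with the rows of $x_1$ and $x'_1$ replaced by $0$ (interim variables $\zeta'$); and the unit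 vectors of $x_1$ and $x'_1$, whose new variables are the latent primary variables $\overline x_1$ and $x'_1$. Localize the partial transform of $f(X')$ at a reduced branch point and perform latent reductions relative to both latent primary variables, obtaining $f(X'')$ with primary variable $x''_1$. The *interim transform* is the Laurent series in the non-exceptional variables, $\zeta'$, $\overline x_1$ and $x'_1$ that $T'$ transforms into $f(X'')$ up to the exceptional monomials factored out in both steps. **Third step.** Let $M''$ be an exponential matrix of $f(X'')$ at a vertex, $E''$ exceptional columns with non-singular $E''\times E''$ block, where the row of $x''_1$ belongs to the block if and only if $x''_1$ is inconsistent with $(M'',E'')$. Let $N''$ be the canonical reduction and $\mathcal Q''=T'\cdot N''$ (both the consistent and the inconsistent case of $x''_1$ are included). Suppose that $\overline x_1$ is inconsistent and $x'_1$ is consistent with $(\mathcal Q'',E'')$. Permute the rows of $\mathcal Q''$ so that its exceptional block is non-singular and the row of $x'_1$ is outside it; let $t''_1$ be the non-exceptional variable that revives $x'_1$ in the canonical reduction of the permuted matrix. Let $q$ be the partial transform of the interim transform under this canonical reduction, at the exponent corresponding to the chosen vertex of $NP(f(X''))$. **Claim.** At every reduced branch point of $q$ that is regular with respect to $t''_1$,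 the order of the localized proper transform of $q$, and hence also the order of the localization of $q$, is strictly less than $d'$. -/

import Mathlib

open Matrix
open scoped NNReal

namespace MonomialResolution

noncomputable section

/- Conventions.  `ι` is a finite set of labels for the variables.  The rows of an exponential matrix
are labelled by the old variables and its columns by the new ones, and the substitution `X = Y ^ M`
sends the monomial `X ^ α` to `Y ^ (α ᵥ* M)`.  Labels carry no order, so every permutation and
relabeling of rows or columns is a choice of labels; an exceptional index set is any `E : Finset ι`
and its canonical position among the columns plays no role. -/

/-! ### Newton polyhedra, vertex cones and exponential matrices -/

section Newton

variable {ι 𝕜 : Type*} [Fintype ι] [DecidableEq ι] [Field 𝕜]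

/-- The real vector with natural entries `v`. -/
def toReal (v : ι → ℕ) : ι → ℝ := fun i => (v i : ℝ)

/-- The Newton polyhedron `conv (supp f) + ℝ_{≥0}^n`. -/
def newtonPolyhedron (f : MvPowerSeries ι 𝕜) : Set (ι → ℝ) :=
  {x | ∃ y ∈ convexHull ℝ {y : ι → ℝ | ∃ α : ι →₀ ℕ, MvPowerSeries.coeff α f ≠ 0 ∧ y = toReal α},
    ∃ v : ι → ℝ, 0 ≤ v ∧ x = y + v}

/-- The face of `P` on which the weight `u` is minimal. -/
def face (P : Set (ι → ℝ)) (u : ι → ℝ) : Set (ι → ℝ) :=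
  {x | x ∈ P ∧ ∀ y ∈ P, u ⬝ᵥ x ≤ u ⬝ᵥ y}

/-- `v` is a normal vector of `P`: it has natural coprime entries and its face is a facet. -/
def IsNormalVector (P : Set (ι → ℝ)) (v : ι → ℕ) : Prop :=
  Finset.univ.gcd v = 1 ∧ (face P (toReal v)).Nonempty ∧
    Module.finrank ℝ (vectorSpan ℝ (face P (toReal v))) + 1 = Fintype.card ι

/-- `a` is a vertex of `P`, that is, a face which is a single point. -/
def IsVertex (P : Set (ι → ℝ)) (a : ι → ℝ) : Prop :=
  ∃ u : ι → ℝ, 0 ≤ u ∧ face P u = {a}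

/-- The generator set of the vertex cone at `a`: the normal vectors whose facet contains `a`. -/
def vertexGenerators (P : Set (ι → ℝ)) (a : ι → ℝ) : Set (ι → ℕ) :=
  {v | IsNormalVector P v ∧ a ∈ face P (toReal v)}

/-- The convex polyhedral cone generated by `V`, without the origin. -/
def cone (V : Set (ι → ℕ)) : Set (ι → ℝ) :=
  {x | x ∈ Submodule.span ℝ≥0 (toReal '' V) ∧ x ≠ 0}

/-- `K` is (the family of generator sets of) a unimodular simplicial refinement of the cone
generated by `G`: the simplicial cones of `K` have lattice determinant `±1`, they fill the cone, any
two of them meet in a common face, and every generator in `G` is used; the remaining generators are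
the auxiliary vectors, which lie in the cone. -/
structure IsSimplicialRefinement (G : Set (ι → ℕ)) (K : Finset (Finset (ι → ℕ))) : Prop where
  unimodular : ∀ V ∈ K, ∃ M : Matrix ι ι ℕ, V = Finset.univ.image (fun j i => M i j) ∧
    IsUnit (M.map (Nat.cast : ℕ → ℤ)).det
  cover : (⋃ V ∈ K, cone (V : Set (ι → ℕ))) = cone G
  common_face : ∀ V ∈ K, ∀ W ∈ K, ∃ V' ⊆ V, ∃ W' ⊆ W,
    cone (V : Set (ι → ℕ)) ∩ cone (W : Set (ι → ℕ)) = cone (V' : Set (ι → ℕ)) ∧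
    cone (V' : Set (ι → ℕ)) = cone (W' : Set (ι → ℕ))
  generators : ∀ v ∈ G, ∃ V ∈ K, v ∈ V

/-- `M` is the exponential matrix of a refined vertex cone of the Newton polyhedron of `f` at the
vertex `a`: its columns generate a cone of a unimodular simplicial refinement of the vertex cone. -/
def IsExponentialMatrix (f : MvPowerSeries ι 𝕜) (a : ι →₀ ℕ) (M : Matrix ι ι ℕ) : Prop :=
  IsVertex (newtonPolyhedron f) (toReal a) ∧
    IsUnit (M.map (Nat.cast : ℕ → ℤ)).det ∧
    ∃ K : Finset (Finset (ι → ℕ)),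
      IsSimplicialRefinement (vertexGenerators (newtonPolyhedron f) (toReal a)) K ∧
        Finset.univ.image (fun j i => M i j) ∈ K

end Newton

/-! ### Consistency, canonical reduction, interim and synthetic exponential matrices -/

section Matrices

variable {ι : Type*} [Fintype ι] [DecidableEq ι]

/-- An exponential matrix with its entries regarded as rational numbers. -/
def ratMatrix (M : Matrix ι ι ℕ) : Matrix ι ι ℚ := M.map (Nat.cast : ℕ → ℚ)

/-- The variable labelling row `p` is consistent with `Q` and `E`: after removal of row `p`, the
exceptional columns of `Q` still have rank `|E|`. -/
def Consistent (Q : Matrix ι ι ℚ) (p : ι) (E : Finset ι) : Prop :=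
  (Q.submatrix (Subtype.val : {i // i ≠ p} → ι) (Subtype.val : {j // j ∈ E} → ι)).rank = E.card

/-- The exceptional submatrix of `Q` is non-degenerate. -/
def NonDegenerate (Q : Matrix ι ι ℚ) (E : Finset ι) : Prop :=
  (Q.submatrix (Subtype.val : {i // i ∈ E} → ι) (Subtype.val : {j // j ∈ E} → ι)).det ≠ 0

/-- The canonical reduction of `Q`: exceptional columns are kept, the others become unit vectors. -/
def canonicalReduction (Q : Matrix ι ι ℚ) (E : Finset ι) : Matrix ι ι ℚ :=
  Matrix.of fun i j => if j ∈ E then Q i j else if i = j then 1 else 0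

/-- The synthetic exponential matrix `T * N`, where `N` is the canonical reduction of `M`. -/
def synthetic (T : Matrix ι ι ℚ) (M : Matrix ι ι ℕ) (E : Finset ι) : Matrix ι ι ℚ :=
  T * canonicalReduction (ratMatrix M) E

/-- The first factor `S` of the decomposition `Q = S * T` that frees the latent primary exponents.
The latent primary variables label the rows `ℓ k`, `k ∈ L`, of `Q`; the column with label `k ∈ L` of
`S` is the unit vector of row `ℓ k`, so that the new variable with label `k` has the same exponent as
the latent primary variable `ℓ k`.  The non-exceptional columns are those of `Q`; the exceptional
columns outside `L`, labelled by the interim variables, are those of `Q` with the rows of the latent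
primary variables replaced by zero. -/
def interimS (Q : Matrix ι ι ℚ) (E L : Finset ι) (ℓ : ι → ι) : Matrix ι ι ℚ :=
  Matrix.of fun i j =>
    if j ∈ L then (if i = ℓ j then 1 else 0)
    else if j ∈ E ∧ i ∈ L.image ℓ then 0 else Q i j

/-- The second factor `T` of the decomposition `Q = S * T`. -/
def interimT (Q : Matrix ι ι ℚ) (E L : Finset ι) (ℓ : ι → ι) : Matrix ι ι ℚ :=
  (interimS Q E L ℓ)⁻¹ * Q

/-- A vector of exponents with rational entries. -/
def ratVec (α : ι →₀ ℕ) : ι → ℚ := fun i => (α i : ℚ)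

/-- Exponents of the synthetic variables that the monomial transformation of `T`, followed by the
extraction of exceptional factors recorded by the offset `b`, sends to the exponent `α`. -/
def syntheticExponent (T : Matrix ι ι ℚ) (b : ι → ℚ) (α : ι →₀ ℕ) : ι → ℚ :=
  b + ratVec α ᵥ* T⁻¹

/-- The offset after one more step: the exponents of the exceptional variables (interim and latent
primary ones) which the vertex `a` acquires under the interim matrix `S`. -/
def nextOffset (T : Matrix ι ι ℚ) (b : ι → ℚ) (M : Matrix ι ι ℕ) (a : ι →₀ ℕ) (E L : Finset ι)
    (ℓ : ι → ι) : ι → ℚ :=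
  fun i => if i ∈ E then
    (syntheticExponent T b a ᵥ* interimS (synthetic T M E) E L ℓ) i else 0

end Matrices

/-! ### Partial transforms and their localization

A (Laurent) series is given by its coefficient function `(ι → ℤ) → 𝕜`. -/

section Transforms

variable {ι 𝕜 : Type*} [Fintype ι] [DecidableEq ι]

/-- The coefficient function of a power series. -/
def ofPowerSeries [Semiring 𝕜] (f : MvPowerSeries ι 𝕜) : (ι → ℤ) → 𝕜 :=
  fun β => ∑ᶠ (α : ι →₀ ℕ) (_ : ∀ i, β i = (α i : ℤ)), MvPowerSeries.coeff α f

/-- The partial transform of `F` under the monomial transformation of `N` (an invertible matrix):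
the exceptional variables, labelled by `E`, are factored out as often as they occur in the transform
of the monomial with exponent `a`. -/
def partialTransform [Semiring 𝕜] (N : Matrix ι ι ℚ) (E : Finset ι) (a : ι → ℚ)
    (F : (ι → ℤ) → 𝕜) : (ι → ℤ) → 𝕜 :=
  fun γ => ∑ᶠ (β : ι → ℤ) (_ : ∀ i, (γ i : ℚ) =
    ((fun k => (β k : ℚ)) ᵥ* N) i - if i ∈ E then (a ᵥ* N) i else 0), F β

variable [NormedField 𝕜]

/-- `q` converges absolutely on a neighbourhood of `s`: on a polydisc in the exceptional variables
and a polyannulus in the non-exceptional ones, where negative exponents are allowed. -/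
def ConvergesAt (E : Finset ι) (s : ι → 𝕜) (q : (ι → ℤ) → 𝕜) : Prop :=
  ∃ δ ρ : ι → ℝ, (∀ i, ‖s i‖ < ρ i) ∧ (∀ i, i ∉ E → 0 < δ i ∧ δ i < ‖s i‖) ∧
    Summable fun γ : ι → ℤ =>
      ‖q γ‖ * ∏ i, (if i ∈ E then ρ i ^ γ i else δ i ^ γ i + ρ i ^ γ i)

/-- The localization `q (Z + s)`, as a power series in `Z`. -/
def localize (s : ι → 𝕜) (q : (ι → ℤ) → 𝕜) : MvPowerSeries ι 𝕜 :=
  fun m => ∑' γ : ι → ℤ,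
    q γ * ∏ i, ((Ring.choose (γ i) (m i) : ℤ) : 𝕜) * s i ^ (γ i - (m i : ℤ))

/-- The restriction of `f` to the locus where the exceptional variables vanish. -/
def proper (E : Finset ι) (f : MvPowerSeries ι 𝕜) : MvPowerSeries ι 𝕜 :=
  fun m => if ∀ i ∈ E, m i = 0 then MvPowerSeries.coeff m f else 0

/-- `s = (s_*, 0)`, with all non-exceptional coordinates nonzero, is a zero of the proper transform
of the partial transform `q`, at which `q` converges. -/
structure IsReducedBranchPoint (E : Finset ι) (q : (ι → ℤ) → 𝕜) (s : ι → 𝕜) : Prop where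
  exceptional : ∀ i ∈ E, s i = 0
  torus : ∀ i, i ∉ E → s i ≠ 0
  converges : ConvergesAt E s q
  vanishes : MvPowerSeries.constantCoeff (proper E (localize s q)) = 0

/-- A reduced branch point is regular with respect to the primary variable labelled `p` if the
localized proper transform does not vanish identically along the axis of that variable. -/
def IsRegular (E : Finset ι) (q : (ι → ℤ) → 𝕜) (s : ι → 𝕜) (p : ι) : Prop :=
  ∃ k : ℕ, MvPowerSeries.coeff (Finsupp.single p k) (proper E (localize s q)) ≠ 0

end Transforms

/-! ### Latent preliminary and Weierstrass reductions -/

section Reductions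

variable {ι 𝕜 : Type*} [Fintype ι] [DecidableEq ι]

/-- A Weierstrass polynomial `x_p ^ d + ∑ c_j x_p ^ (d - j)`, `2 ≤ j ≤ d`, whose coefficients `c_j`
are power series in the other variables without constant term. -/
def IsWeierstrassPolynomial [Semiring 𝕜] (p : ι) (d : ℕ) (w : MvPowerSeries ι 𝕜) : Prop :=
  MvPowerSeries.coeff (Finsupp.single p d) w = 1 ∧
    ∀ α : ι →₀ ℕ, MvPowerSeries.coeff α w ≠ 0 →
      α = Finsupp.single p d ∨ (α p + 2 ≤ d ∧ ∃ i, i ≠ p ∧ α i ≠ 0)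

/-- The latent primary components of the exponent `α` all vanish. -/
def LatentZero (T : Matrix ι ι ℚ) (L : Finset ι) (α : ι →₀ ℕ) : Prop :=
  ∀ k ∈ L, (ratVec α ᵥ* T⁻¹) k = 0

open Classical in
/-- The latent reducible function: the terms of `f` whose latent primary components vanish. -/
def latentReducible [Semiring 𝕜] (T : Matrix ι ι ℚ) (L : Finset ι) (f : MvPowerSeries ι 𝕜) :
    MvPowerSeries ι 𝕜 :=
  fun α => if LatentZero T L α then MvPowerSeries.coeff α f else 0

/-- `f` arises from the localized partial transform `h` by latent preliminary and Weierstrass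
reductions, with primary variable labelled `p` and singularity height `d`.  In turn one performs an
invertible linear modification `A` of the non-exceptional variables, the completion of perfect power
`x_p ↦ x_p + g`, and the division by the redundant unit (multiplication by `v`), after which the
latent reducible function is a Weierstrass polynomial in `x_p` of degree `d`.  The latter two steps
take place among series whose latent primary components vanish. -/
def IsLatentReduction [Field 𝕜] (T : Matrix ι ι ℚ) (E L : Finset ι) (p : ι) (d : ℕ)
    (h : MvPowerSeries ι 𝕜) (f : MvPowerSeries ι 𝕜) : Prop :=
  ∃ (A : Matrix ι ι 𝕜) (g v : MvPowerSeries ι 𝕜),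
    (A.det ≠ 0 ∧ ∀ i j, (i ∈ E ∨ j ∈ E) → A i j = if i = j then 1 else 0) ∧
    (MvPowerSeries.constantCoeff g = 0 ∧
      ∀ α, MvPowerSeries.coeff α g ≠ 0 → α p = 0 ∧ LatentZero T L α) ∧
    (MvPowerSeries.constantCoeff v ≠ 0 ∧ ∀ α, MvPowerSeries.coeff α v ≠ 0 → LatentZero T L α) ∧
    f = v * MvPowerSeries.subst (fun i => MvPowerSeries.X i + if i = p then g else 0)
      (MvPowerSeries.subst
        (fun i => ∑ j, MvPowerSeries.C (A i j) * (MvPowerSeries.X j : MvPowerSeries ι 𝕜)) h) ∧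
    IsWeierstrassPolynomial p d (latentReducible T L f)

end Reductions

/-! ### The resolution steps -/

section Steps

variable {ι 𝕜 : Type*} [Fintype ι] [DecidableEq ι] [NormedField 𝕜]

/-- The partial transform of `f` under the canonical reduction of the exponential matrix `M`. -/
def reducedTransform (f : MvPowerSeries ι 𝕜) (a : ι →₀ ℕ) (M : Matrix ι ι ℕ) (E : Finset ι) :
    (ι → ℤ) → 𝕜 :=
  partialTransform (canonicalReduction (ratMatrix M) E) E (ratVec a) (ofPowerSeries f)

/-- One step of the resolution of inconsistent singularities, from the function `f` with primary
variable `p` to the function `f'` with primary variable `p'` and singularity height `d'`.  The matrix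
`T` is the interim matrix that sends the synthetic variables to the variables of `f`.  The primary
variable `p` is inconsistent with the exponential matrix `M` and becomes latent; the latent primary
variables, that is, the rows `ℓ k`, `k ∈ L`, of the synthetic matrix, are all inconsistent with it. -/
structure IsInconsistentStep (T : Matrix ι ι ℚ) (L : Finset ι) (ℓ : ι → ι)
    (f : MvPowerSeries ι 𝕜) (p : ι) (a : ι →₀ ℕ) (M : Matrix ι ι ℕ) (E : Finset ι) (s : ι → 𝕜)
    (f' : MvPowerSeries ι 𝕜) (p' : ι) (d' : ℕ) : Prop where
  exponential : IsExponentialMatrix f a M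
  nonDegenerate : NonDegenerate (ratMatrix M) E
  primary_mem : p ∈ E
  inconsistent : ¬ Consistent (ratMatrix M) p E
  latent : ∀ k ∈ L, k ∈ E ∧ ¬ Consistent (synthetic T M E) (ℓ k) E
  decomposition : (interimS (synthetic T M E) E L ℓ).det ≠ 0
  branch : IsReducedBranchPoint E (reducedTransform f a M E) s
  primary'_notMem : p' ∉ E
  height : (proper E (localize s (reducedTransform f a M E))).order = (d' : ℕ∞)
  reduction : IsLatentReduction (interimT (synthetic T M E) E L ℓ) E L p' d'
    (localize s (reducedTransform f a M E)) f'

/-- The interim transform belonging to `f`: the series in the synthetic variables whose transform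
under `T` is `f` up to the exceptional factors recorded by `b`.  The permutation `σ` relabels the
synthetic variables. -/
def interimTransform (T : Matrix ι ι ℚ) (b : ι → ℚ) (σ : Equiv.Perm ι) (f : MvPowerSeries ι 𝕜) :
    (ι → ℤ) → 𝕜 :=
  fun β => ∑ᶠ (α : ι →₀ ℕ) (_ : ∀ i, (β i : ℚ) = syntheticExponent T b α (σ i)),
    MvPowerSeries.coeff α f

/-- The partial transform of the interim transform under the canonical reduction of the synthetic
matrix `Q` with its rows relabelled by `σ`. -/
def syntheticTransform (T : Matrix ι ι ℚ) (b : ι → ℚ) (σ : Equiv.Perm ι) (Q : Matrix ι ι ℚ)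
    (E : Finset ι) (a : ι →₀ ℕ) (f : MvPowerSeries ι 𝕜) : (ι → ℤ) → 𝕜 :=
  partialTransform (canonicalReduction (Q.submatrix σ id) E) E
    (fun i => syntheticExponent T b a (σ i)) (interimTransform T b σ f)

end Steps

end

end MonomialResolution

/-! The proof follows the single monomial `ζ`, which is `x'₁ ^ d₁`, and ends with the Tschirnhausen
argument: at a nonzero point, a polynomial of degree `d₁` without a term of degree `d₁ - 1` cannot
vanish to order `d₁` in characteristic zero.

Let λ be the latent component along `x₁` of exponents of `f₁`. Among the terms with λ = 0, the
Weierstrass condition allows only `ζ` and exponents of `x'₁` at most `d₁ - 2`; it says nothing about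
the other terms. So everything depends on confining the exceptional face of `q` to λ = 0 whenever
`x'₁` reaches exponent `d₁` there.

Inconsistency of a row means that the corresponding column of the inverse matrix is supported on the
exceptional indices (`inv_apply_eq_zero_of_not_consistent`). Latent components therefore depend only
on exceptional exponents. Localization retains these, and latent reductions are homogeneous for the
resulting grading, so a step merely translates the components by those of the vertex
(`IsInconsistentStep.syntheticComponents_eq`). As `ζ` is the only term of `f₁` with its pair of
components, it cannot cancel and yields an exponent `ε` of `f₂` (`exists_coeff_ne_zero_of_unique`).

On the exceptional face of `q` the exponent of `t''₁` is the exponent of `x'₁` in a source term `β`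
of `f₁`, and the component along the still inconsistent `x̄₁` is constant. If `β p₁ ≥ d₁`, then `ζ ≤
β`, hence `ε ≤ α` for the corresponding exponent `α` of `f₂`. Minimality at the vertex puts `ε` on
the face too, and the constant is the one for λ = 0. The exponents of `t''₁` on the face are then
`d₁` or at most `d₁ - 2`; otherwise all are below `d₁`. `exists_coeff_localize_single_ne_zero_lt`
concludes. -/

namespace MonomialResolution

/-! ### Minimality of the vertex for the columns of an exponential matrix. -/

section Newton

variable {ι 𝕜 : Type*} [Field 𝕜]

theorem toReal_mem_newtonPolyhedron {f : MvPowerSeries ι 𝕜} {α : ι →₀ ℕ}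
    (hα : MvPowerSeries.coeff α f ≠ 0) : toReal α ∈ newtonPolyhedron f :=
  ⟨toReal α, subset_convexHull ℝ _ ⟨α, hα, rfl⟩, 0, le_rfl, (add_zero _).symm⟩

/-- The columns of an exponential matrix at `a` attain their minimum over the support at `a`. -/
theorem IsExponentialMatrix.sum_le [Fintype ι] [DecidableEq ι] {f : MvPowerSeries ι 𝕜} {a α : ι →₀ ℕ} {M : Matrix ι ι ℕ}
    (hM : IsExponentialMatrix f a M) (hα : MvPowerSeries.coeff α f ≠ 0) (j : ι) :
    ∑ i, a i * M i j ≤ ∑ i, α i * M i j := by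
  obtain ⟨-, hdet, K, hK, hmem⟩ := hM
  -- `cone` omits the origin, so membership in it needs a nonzero column.
  have hne : toReal (fun i => M i j) ≠ 0 := by
    intro h0
    have : (M.map (Nat.cast : ℕ → ℤ)).det = 0 := by
      refine Matrix.det_eq_zero_of_column_eq_zero j fun i => ?_
      have := congrFun h0 i
      simpa [toReal] using this
    rw [this] at hdet
    exact not_isUnit_zero hdet
  have hcone : toReal (fun i => M i j) ∈
      cone (vertexGenerators (newtonPolyhedron f) (toReal a)) := by
    rw [← hK.cover]
    refine Set.mem_biUnion hmem ⟨Submodule.subset_span ⟨_, ?_, rfl⟩, hne⟩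
    simp
  -- The inequality is preserved by nonnegative combinations, so it need only be checked on normal
  -- vectors of facets through `a`.
  have key : ∀ x ∈ Submodule.span ℝ≥0
      (toReal '' vertexGenerators (newtonPolyhedron f) (toReal a)),
      x ⬝ᵥ toReal a ≤ x ⬝ᵥ toReal α := by
    intro x hx
    induction hx using Submodule.span_induction with
    | mem x h =>
      obtain ⟨v, hv, rfl⟩ := h
      exact hv.2.2 _ (toReal_mem_newtonPolyhedron hα)
    | zero => simp
    | add x y _ _ hx hy => simpa [add_dotProduct] using add_le_add hx hy
    | smul c x _ hx =>
      simpa [smul_dotProduct, NNReal.smul_def] using mul_le_mul_of_nonneg_left hx c.2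
  have := key _ hcone.1
  simp only [dotProduct, toReal] at this
  simp only [mul_comm _ (M _ j)]
  exact_mod_cast this

end Newton

/-! ### Inconsistent rows, and inverses of interim matrices. -/

section Matrices

variable {ι : Type*}

theorem ratVec_add (α β : ι →₀ ℕ) : ratVec (α + β) = ratVec α + ratVec β := by
  ext i; simp [ratVec]

theorem ratVec_zero : ratVec (0 : ι →₀ ℕ) = 0 := by
  ext i; simp [ratVec]

theorem ratVec_single [DecidableEq ι] (i : ι) (n : ℕ) : ratVec (Finsupp.single i n) = Pi.single i (n : ℚ) := by
  ext j
  by_cases h : j = i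
  · subst h; simp [ratVec]
  · simp [ratVec, h]

variable [Fintype ι] [DecidableEq ι]

theorem det_canonicalReduction_ne_zero {Q : Matrix ι ι ℚ} {E : Finset ι}
    (h : NonDegenerate Q E) : (canonicalReduction Q E).det ≠ 0 := by
  rw [Matrix.twoBlockTriangular_det' _ (fun i => i ∈ E)]
  · have h1 : (canonicalReduction Q E).toSquareBlockProp (fun i => i ∈ E) =
        Q.submatrix (Subtype.val : {i // i ∈ E} → ι) (Subtype.val : {j // j ∈ E} → ι) := by
      ext i j
      simp [canonicalReduction, Matrix.toSquareBlockProp]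
    have h2 : (canonicalReduction Q E).toSquareBlockProp (fun i => ¬ i ∈ E) = 1 := by
      ext i j
      simp [canonicalReduction, Matrix.toSquareBlockProp, j.2, Matrix.one_apply, Subtype.ext_iff]
    rw [h1, h2, det_one, mul_one]
    convert h
  · intro i hi j hj
    have : i ≠ j := fun h => hj (h ▸ hi)
    simp [canonicalReduction, hj, this]

/-- If the row `p` is inconsistent, the column `p` of the inverse is supported on `E`. -/
theorem inv_apply_eq_zero_of_not_consistent {Q : Matrix ι ι ℚ} {p : ι} {E : Finset ι}
    (hQ : IsUnit Q.det) (h : ¬ Consistent Q p E) {j : ι} (hj : j ∉ E) : Q⁻¹ j p = 0 := by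
  set B := Q.submatrix (Subtype.val : {i // i ≠ p} → ι) (Subtype.val : {j // j ∈ E} → ι) with hB
  have hinj : ¬ Function.Injective B.mulVecLin := by
    intro hinj
    apply h
    have := LinearMap.finrank_range_of_inj hinj
    simpa [Consistent, Matrix.rank] using this
  obtain ⟨c, hc, hc0⟩ : ∃ c, B *ᵥ c = 0 ∧ c ≠ 0 := by
    by_contra! hcon
    exact hinj ((injective_iff_map_eq_zero _).2 fun c hc => hcon c hc)
  -- The exceptional columns become dependent without row `p`. The dependency, extended by zero, is
  -- sent by `Q` to a multiple of the unit vector of `p`, so it is a multiple of column `p` of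
  -- `Q⁻¹`.
  let c' : ι → ℚ := fun i => if hi : i ∈ E then c ⟨i, hi⟩ else 0
  have hc' : Q *ᵥ c' = Pi.single p ((Q *ᵥ c') p) := by
    ext i
    by_cases hi : i = p
    · subst hi; simp
    · rw [Pi.single_eq_of_ne hi]
      have := congrFun hc ⟨i, hi⟩
      simp only [mulVec, dotProduct, hB, submatrix_apply, Pi.zero_apply] at this
      rw [Finset.sum_coe_sort_eq_attach, Finset.sum_attach_eq_sum_dite] at this
      simp only [mulVec, dotProduct, c', mul_dite, mul_zero]
      exact this
  set t := (Q *ᵥ c') p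
  have hcol : c' = fun i => Q⁻¹ i p * t := by
    have := congrArg (Q⁻¹ *ᵥ ·) hc'
    simp only [mulVec_mulVec, Matrix.nonsing_inv_mul _ hQ, one_mulVec, mulVec_single] at this
    rw [this]
    ext i
    simp
  have ht : t ≠ 0 := by
    intro ht
    apply hc0
    ext i
    have := congrFun hcol i
    simpa [c', ht] using this
  have := congrFun hcol j
  simpa [c', hj, ht] using this

theorem isUnit_det_interimT {Q : Matrix ι ι ℚ} {E L : Finset ι} {ℓ : ι → ι}
    (hS : (interimS Q E L ℓ).det ≠ 0) (hQ : IsUnit Q.det) : IsUnit (interimT Q E L ℓ).det := by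
  rw [interimT, det_mul]
  exact (Matrix.isUnit_nonsing_inv_det _ hS.isUnit).mul hQ

theorem interimT_inv {Q : Matrix ι ι ℚ} {E L : Finset ι} {ℓ : ι → ι}
    (hS : (interimS Q E L ℓ).det ≠ 0) : (interimT Q E L ℓ)⁻¹ = Q⁻¹ * interimS Q E L ℓ := by
  rw [interimT, Matrix.mul_inv_rev, Matrix.nonsing_inv_nonsing_inv _ hS.isUnit]

/-- Column `k` of `S` is the unit vector of row `ℓ k`, so it selects a column of `Q⁻¹`. This carries
inconsistency over to the interim matrix. -/
theorem interimT_inv_apply_of_mem {Q : Matrix ι ι ℚ} {E L : Finset ι} {ℓ : ι → ι}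
    (hS : (interimS Q E L ℓ).det ≠ 0) (i : ι) {k : ι} (hk : k ∈ L) :
    (interimT Q E L ℓ)⁻¹ i k = Q⁻¹ i (ℓ k) := by
  simp [interimT_inv hS, Matrix.mul_apply, interimS, hk]

/-- Here `S` and `Q` share column `k`, so `Q⁻¹ * S` has a unit vector there. -/
theorem interimT_inv_apply_of_notMem {Q : Matrix ι ι ℚ} {E L : Finset ι} {ℓ : ι → ι}
    (hS : (interimS Q E L ℓ).det ≠ 0) (hQ : IsUnit Q.det) (i : ι) {k : ι} (hk : k ∉ L)
    (hkE : k ∉ E) : (interimT Q E L ℓ)⁻¹ i k = (1 : Matrix ι ι ℚ) i k := by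
  rw [interimT_inv hS, ← Matrix.nonsing_inv_mul _ hQ]
  simp [Matrix.mul_apply, interimS, hk, hkE]

/-- A column of `canonicalReduction` on `E` pairs with exponents as the original matrix does. -/
theorem ratVec_vecMul_canonicalReduction_of_mem (α : ι →₀ ℕ) (M : Matrix ι ι ℕ) {E : Finset ι}
    {j : ι} (hj : j ∈ E) :
    (ratVec α ᵥ* canonicalReduction (ratMatrix M) E) j = ((∑ i, α i * M i j : ℕ) : ℚ) := by
  simp [vecMul, dotProduct, ratVec, canonicalReduction, hj, ratMatrix]

theorem vecMul_canonicalReduction_of_notMem (α : ι → ℚ) (Q : Matrix ι ι ℚ) {E : Finset ι}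
    {j : ι} (hj : j ∉ E) : (α ᵥ* canonicalReduction Q E) j = α j := by
  simp [vecMul, dotProduct, canonicalReduction, hj]

/-- The components of an exponent with respect to the synthetic variables. -/
noncomputable def syntheticComponents (T : Matrix ι ι ℚ) : (ι →₀ ℕ) →+ (ι → ℚ) where
  toFun α := ratVec α ᵥ* T⁻¹
  map_zero' := by rw [ratVec_zero, zero_vecMul]
  map_add' α β := by rw [ratVec_add, add_vecMul]

theorem syntheticComponents_apply (T : Matrix ι ι ℚ) (α : ι →₀ ℕ) (k : ι) :
    syntheticComponents T α k = ∑ i, (α i : ℚ) * T⁻¹ i k := rfl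

end Matrices

end MonomialResolution

namespace MonomialResolution

/-! ### Exponents of substituted power series; isolated monomials. -/

section Substitution

variable {ι 𝕜 : Type*} [Field 𝕜]

/-- Exponents of products of power series are related to exponents of factors by any additive
relation. -/
theorem mem_of_coeff_prod_ne_zero (R : AddSubmonoid ((ι →₀ ℕ) × (ι →₀ ℕ)))
    {a : ι → MvPowerSeries ι 𝕜}
    (hR : ∀ s e, MvPowerSeries.coeff e (a s) ≠ 0 → (Finsupp.single s 1, e) ∈ R)
    (d e : ι →₀ ℕ) (h : MvPowerSeries.coeff e (d.prod fun s n => a s ^ n) ≠ 0) : (d, e) ∈ R := by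
  classical
  have hone : ∀ e, MvPowerSeries.coeff e (1 : MvPowerSeries ι 𝕜) ≠ 0 → (0, e) ∈ R := by
    intro e he
    rw [MvPowerSeries.coeff_one] at he
    have : e = 0 := by by_contra h; simp [h] at he
    subst this
    exact R.zero_mem
  have hmul : ∀ (d₁ d₂ : ι →₀ ℕ) (f₁ f₂ : MvPowerSeries ι 𝕜),
      (∀ e, MvPowerSeries.coeff e f₁ ≠ 0 → (d₁, e) ∈ R) →
      (∀ e, MvPowerSeries.coeff e f₂ ≠ 0 → (d₂, e) ∈ R) →
      ∀ e, MvPowerSeries.coeff e (f₁ * f₂) ≠ 0 → (d₁ + d₂, e) ∈ R := by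
    intro d₁ d₂ f₁ f₂ h₁ h₂ e he
    rw [MvPowerSeries.coeff_mul] at he
    obtain ⟨x, hx, hx0⟩ := Finset.exists_ne_zero_of_sum_ne_zero he
    rw [← Finset.HasAntidiagonal.mem_antidiagonal.1 hx]
    exact R.add_mem (h₁ _ (left_ne_zero_of_mul hx0)) (h₂ _ (right_ne_zero_of_mul hx0))
  have hpow : ∀ s n e, MvPowerSeries.coeff e (a s ^ n) ≠ 0 → (Finsupp.single s n, e) ∈ R := by
    intro s n
    induction n with
    | zero => simpa using hone
    | succ n ih =>
      intro e he
      rw [pow_succ] at he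
      rw [Finsupp.single_add]
      exact hmul _ _ _ _ ih (hR s) e he
  induction d using Finsupp.induction generalizing e with
  | zero => exact hone e (by simpa using h)
  | single_add s n d hs hn ih =>
    rw [Finsupp.prod_add_index' (by simp) (fun _ _ _ => pow_add _ _ _),
      Finsupp.prod_single_index (by simp)] at h
    exact hmul _ _ _ _ (hpow s n) ih e h

theorem exists_of_coeff_subst_ne_zero (R : AddSubmonoid ((ι →₀ ℕ) × (ι →₀ ℕ)))
    {a : ι → MvPowerSeries ι 𝕜} (ha : MvPowerSeries.HasSubst a)
    (hR : ∀ s e, MvPowerSeries.coeff e (a s) ≠ 0 → (Finsupp.single s 1, e) ∈ R)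
    {f : MvPowerSeries ι 𝕜} {e : ι →₀ ℕ} (h : MvPowerSeries.coeff e (MvPowerSeries.subst a f) ≠ 0) :
    ∃ d, MvPowerSeries.coeff d f ≠ 0 ∧
      MvPowerSeries.coeff e (d.prod fun s n => a s ^ n) ≠ 0 ∧ (d, e) ∈ R := by
  rw [MvPowerSeries.coeff_subst ha] at h
  obtain ⟨d, hd⟩ : ∃ d, MvPowerSeries.coeff d f •
      MvPowerSeries.coeff e (d.prod fun s n => a s ^ n) ≠ 0 := by
    by_contra! hcon
    exact h (finsum_eq_zero_of_forall_eq_zero hcon)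
  have hd2 := right_ne_zero_of_smul hd
  exact ⟨d, left_ne_zero_of_smul hd, hd2, mem_of_coeff_prod_ne_zero R hR d e hd2⟩

/-- `ε` is an exponent of `f`, and no other exponent of `f` has the same degree under `φ`. -/
def IsIsolatedExponent {G : Type*} [AddCommGroup G] (φ : (ι →₀ ℕ) →+ G) (ε : ι →₀ ℕ)
    (f : MvPowerSeries ι 𝕜) : Prop :=
  MvPowerSeries.coeff ε f ≠ 0 ∧ ∀ α, MvPowerSeries.coeff α f ≠ 0 → φ α = φ ε → α = ε

/-- Substitutions that preserve the grading and fix the variables of an isolated monomial keep it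
isolated. -/
theorem IsIsolatedExponent.subst {G : Type*} [AddCommGroup G] {φ : (ι →₀ ℕ) →+ G} {ε : ι →₀ ℕ}
    {f : MvPowerSeries ι 𝕜} (hf : IsIsolatedExponent φ ε f) {a : ι → MvPowerSeries ι 𝕜}
    (ha : MvPowerSeries.HasSubst a)
    (hφ : ∀ s e, MvPowerSeries.coeff e (a s) ≠ 0 → φ (Finsupp.single s 1) = φ e)
    (hX : ∀ s, ε s ≠ 0 → a s = MvPowerSeries.X s) :
    IsIsolatedExponent φ ε (MvPowerSeries.subst a f) := by
  classical
  have hmon : (ε.prod fun s n => a s ^ n) = MvPowerSeries.monomial ε (1 : 𝕜) := by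
    rw [MvPowerSeries.monomial_one_eq]
    refine Finsupp.prod_congr fun s hs => ?_
    rw [hX s (Finsupp.mem_support_iff.1 hs)]
  let R : AddSubmonoid ((ι →₀ ℕ) × (ι →₀ ℕ)) :=
    { carrier := {x | φ x.1 = φ x.2}
      zero_mem' := rfl
      add_mem' := fun {x y} hx hy => by
        change φ _ = φ _ at hx
        change φ _ = φ _ at hy
        change φ (x.1 + y.1) = φ (x.2 + y.2)
        rw [map_add, map_add, hx, hy] }
  constructor
  · rw [MvPowerSeries.coeff_subst ha, finsum_eq_single _ ε, hmon, MvPowerSeries.coeff_monomial_same,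
      smul_eq_mul, mul_one]
    · exact hf.1
    -- Homogeneity excludes cancellation: any other term contributing to `ε` would have its degree.
    · intro d hd
      by_contra h0
      have hR := mem_of_coeff_prod_ne_zero R hφ d ε (right_ne_zero_of_smul h0)
      exact hd (hf.2 d (left_ne_zero_of_smul h0) hR)
  · intro α hα hαε
    obtain ⟨d, hd, hdα, hR⟩ := exists_of_coeff_subst_ne_zero R ha hφ hα
    have : d = ε := hf.2 d hd ((show φ d = φ α from hR).trans hαε)
    subst this
    rw [hmon, MvPowerSeries.coeff_monomial] at hdα
    by_contra h
    simp [h] at hdα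

/-- Terms of `v` have degree zero, so a product reaching `ε` must use `ε` itself from `f`, and thus
the constant term of `v`. -/
theorem IsIsolatedExponent.unit_mul {G : Type*} [AddCommGroup G] {φ : (ι →₀ ℕ) →+ G} {ε : ι →₀ ℕ}
    {f v : MvPowerSeries ι 𝕜} (hf : IsIsolatedExponent φ ε f)
    (hv : MvPowerSeries.constantCoeff v ≠ 0) (hφ : ∀ α, MvPowerSeries.coeff α v ≠ 0 → φ α = 0) :
    MvPowerSeries.coeff ε (v * f) ≠ 0 := by
  classical
  rw [MvPowerSeries.coeff_mul, Finset.sum_eq_single (0, ε)]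
  · rw [MvPowerSeries.coeff_zero_eq_constantCoeff_apply]
    exact mul_ne_zero hv hf.1
  · intro x hx hne
    by_contra h0
    have hsum := Finset.HasAntidiagonal.mem_antidiagonal.1 hx
    have h2 : x.2 = ε := by
      refine hf.2 _ (right_ne_zero_of_mul h0) ?_
      rw [← hsum, map_add, hφ _ (left_ne_zero_of_mul h0), zero_add]
    have h1 : x.1 = 0 := by simpa [h2] using hsum
    exact hne (Prod.ext h1 h2)
  · simp

end Substitution

/-! ### Latent reductions are homogeneous for the latent components. -/

section Reductions

variable {ι 𝕜 : Type*} [Fintype ι] [DecidableEq ι] [Field 𝕜]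

/-- The latent components of an exponent. -/
noncomputable def latentComponents (T : Matrix ι ι ℚ) (L : Finset ι) : (ι →₀ ℕ) →+ (L → ℚ) where
  toFun α k := syntheticComponents T α k
  map_zero' := by ext; simp
  map_add' α β := by ext; simp

theorem latentZero_iff {T : Matrix ι ι ℚ} {L : Finset ι} {α : ι →₀ ℕ} :
    LatentZero T L α ↔ latentComponents T L α = 0 :=
  ⟨fun h => funext fun k => h k k.2, fun h k hk => congrFun h ⟨k, hk⟩⟩

/-- Non-exceptional variables have latent degree zero, which is why mixing them linearly or
translating one by `g` respects the grading. -/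
theorem latentComponents_single_of_notMem {T : Matrix ι ι ℚ} {E L : Finset ι}
    (hT : ∀ k ∈ L, ∀ i ∉ E, T⁻¹ i k = 0) {i : ι} (hi : i ∉ E) (n : ℕ) :
    latentComponents T L (Finsupp.single i n) = 0 := by
  ext k
  change (ratVec (Finsupp.single i n) ᵥ* T⁻¹) k = 0
  simp [ratVec_single, hT k k.2 i hi]

/-- The linear forms of a linear modification of the non-exceptional variables. -/
theorem linearForm_coeff_ne_zero {A : Matrix ι ι 𝕜} {i : ι} {e : ι →₀ ℕ}
    (h : MvPowerSeries.coeff e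
      (∑ j, MvPowerSeries.C (A i j) * (MvPowerSeries.X j : MvPowerSeries ι 𝕜)) ≠ 0) :
    ∃ j, A i j ≠ 0 ∧ e = Finsupp.single j 1 := by
  rw [map_sum] at h
  obtain ⟨j, -, hj⟩ := Finset.exists_ne_zero_of_sum_ne_zero h
  rw [MvPowerSeries.coeff_C_mul, MvPowerSeries.coeff_X] at hj
  refine ⟨j, left_ne_zero_of_mul hj, ?_⟩
  by_contra hne
  simp [hne] at hj

variable {T : Matrix ι ι ℚ} {E L : Finset ι} {p : ι} {d : ℕ} {h f : MvPowerSeries ι 𝕜}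

/-- Latent reductions preserve latent components and do not decrease exceptional exponents. -/
theorem IsLatentReduction.exists_of_coeff_ne_zero (H : IsLatentReduction T E L p d h f)
    (hT : ∀ k ∈ L, ∀ i ∉ E, T⁻¹ i k = 0) (hp : p ∉ E) {α : ι →₀ ℕ}
    (hα : MvPowerSeries.coeff α f ≠ 0) :
    ∃ β, MvPowerSeries.coeff β h ≠ 0 ∧ latentComponents T L β = latentComponents T L α ∧
      ∀ i ∈ E, β i ≤ α i := by
  obtain ⟨A, g, v, ⟨-, hA⟩, ⟨hg0, hg⟩, ⟨hv0, hv⟩, rfl, -⟩ := H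
  -- Equality of latent components and monotonicity of exceptional exponents are both additive, so
  -- they need only be checked on the images of single variables.
  let R : AddSubmonoid ((ι →₀ ℕ) × (ι →₀ ℕ)) :=
    { carrier := {x | latentComponents T L x.1 = latentComponents T L x.2 ∧ ∀ i ∈ E, x.1 i ≤ x.2 i}
      zero_mem' := ⟨rfl, fun _ _ => le_rfl⟩
      add_mem' := fun {x y} hx hy => by
        refine ⟨?_, fun i hi => add_le_add (hx.2 i hi) (hy.2 i hi)⟩
        rw [Prod.fst_add, Prod.snd_add, map_add, map_add, hx.1, hy.1] }
  rw [MvPowerSeries.coeff_mul] at hα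
  obtain ⟨x, hx, hx0⟩ := Finset.exists_ne_zero_of_sum_ne_zero hα
  have hxα := Finset.HasAntidiagonal.mem_antidiagonal.1 hx
  obtain ⟨e, he, -, heR⟩ := exists_of_coeff_subst_ne_zero R
    (MvPowerSeries.hasSubst_of_constantCoeff_zero (by intro s; split_ifs <;> simp [hg0]))
    (by
      intro s e he
      by_cases hes : e = Finsupp.single s 1
      · subst hes
        exact ⟨rfl, fun _ _ => le_rfl⟩
      · rw [map_add, MvPowerSeries.coeff_X, if_neg hes, zero_add] at he
        by_cases hsp : s = p
        · subst hsp
          rw [if_pos rfl] at he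
          refine ⟨?_, fun i hi => ?_⟩
          · rw [latentComponents_single_of_notMem hT hp, latentZero_iff.1 (hg e he).2]
          · have : s ≠ i := fun h => hp (h ▸ hi)
            simp [this]
        · simp [hsp] at he) (right_ne_zero_of_mul hx0)
  obtain ⟨b, hb, -, hbR⟩ := exists_of_coeff_subst_ne_zero R
    (MvPowerSeries.hasSubst_of_constantCoeff_zero (by intro s; simp))
    (by
      intro s e he
      obtain ⟨j, hj, rfl⟩ := linearForm_coeff_ne_zero he
      by_cases hsj : s = j
      · subst hsj
        exact ⟨rfl, fun _ _ => le_rfl⟩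
      · have hs : s ∉ E := fun hs => hj (by rw [hA s j (Or.inl hs), if_neg hsj])
        have hjE : j ∉ E := fun hs => hj (by rw [hA s j (Or.inr hs), if_neg hsj])
        refine ⟨?_, fun i hi => ?_⟩
        · rw [latentComponents_single_of_notMem hT hs, latentComponents_single_of_notMem hT hjE]
        · have : s ≠ i := fun h => hs (h ▸ hi)
          simp [this]) he
  refine ⟨b, hb, ?_, fun i hi => ?_⟩
  · rw [hbR.1, heR.1, ← hxα, map_add, latentZero_iff.1 (hv _ (left_ne_zero_of_mul hx0)), zero_add]
  · rw [← hxα]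
    exact ((hbR.2 i hi).trans (heR.2 i hi)).trans (by simp)

/-- Latent reductions preserve an isolated monomial in the exceptional variables. -/
theorem IsLatentReduction.coeff_ne_zero_of_isolated (H : IsLatentReduction T E L p d h f)
    (hT : ∀ k ∈ L, ∀ i ∉ E, T⁻¹ i k = 0) (hp : p ∉ E) {ε : ι →₀ ℕ} (hε : ∀ i ∉ E, ε i = 0)
    (hi : IsIsolatedExponent (latentComponents T L) ε h) : MvPowerSeries.coeff ε f ≠ 0 := by
  obtain ⟨A, g, v, ⟨-, hA⟩, ⟨hg0, hg⟩, ⟨hv0, hv⟩, rfl, -⟩ := H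
  have hmem : ∀ {s}, ε s ≠ 0 → s ∈ E := fun {s} hs => by
    by_contra hsE
    exact hs (hε s hsE)
  refine IsIsolatedExponent.unit_mul (φ := latentComponents T L) ?_ hv0
    fun α hα => latentZero_iff.1 (hv α hα)
  refine IsIsolatedExponent.subst ?_
    (MvPowerSeries.hasSubst_of_constantCoeff_zero (by intro s; split_ifs <;> simp [hg0])) ?_ ?_
  · refine hi.subst (MvPowerSeries.hasSubst_of_constantCoeff_zero (by intro s; simp)) ?_ ?_
    · intro s e he
      obtain ⟨j, hj, rfl⟩ := linearForm_coeff_ne_zero he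
      by_cases hsj : s = j
      · rw [hsj]
      · have hs : s ∉ E := fun hs => hj (by rw [hA s j (Or.inl hs), if_neg hsj])
        have hjE : j ∉ E := fun hs => hj (by rw [hA s j (Or.inr hs), if_neg hsj])
        rw [latentComponents_single_of_notMem hT hs, latentComponents_single_of_notMem hT hjE]
    · intro s hs
      simp [hA s _ (Or.inl (hmem hs))]
  · intro s e he
    by_cases hes : e = Finsupp.single s 1
    · rw [hes]
    · rw [map_add, MvPowerSeries.coeff_X, if_neg hes, zero_add] at he
      by_cases hsp : s = p
      · subst hsp
        rw [if_pos rfl] at he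
        rw [latentComponents_single_of_notMem hT hp, latentZero_iff.1 (hg e he).2]
      · simp [hsp] at he
  · intro s hs
    have : s ≠ p := fun h => hp (h ▸ hmem hs)
    simp [this]

end Reductions

/-! ### Coefficients of partial transforms. -/

section Transforms

variable {ι 𝕜 : Type*}

theorem exists_of_ofPowerSeries_ne_zero [Semiring 𝕜] {f : MvPowerSeries ι 𝕜} {β : ι → ℤ}
    (h : ofPowerSeries f β ≠ 0) :
    ∃ α : ι →₀ ℕ, (∀ i, β i = α i) ∧ MvPowerSeries.coeff α f ≠ 0 := by
  classical
  by_contra! hcon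
  refine h (finsum_eq_zero_of_forall_eq_zero fun α => ?_)
  rw [finsum_eq_if]
  split_ifs with hα
  exacts [hcon α hα, rfl]

theorem ofPowerSeries_natCast [Semiring 𝕜] (f : MvPowerSeries ι 𝕜) (α : ι →₀ ℕ) :
    ofPowerSeries f (fun i => (α i : ℤ)) = MvPowerSeries.coeff α f := by
  classical
  rw [ofPowerSeries, finsum_eq_single _ α]
  · simp
  · intro β hβ
    rw [finsum_eq_if, if_neg]
    exact fun h => hβ (Finsupp.ext fun i => by exact_mod_cast (h i).symm)

variable [Fintype ι] [DecidableEq ι]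

theorem exists_of_partialTransform_ne_zero [Semiring 𝕜] {N : Matrix ι ι ℚ} {E : Finset ι}
    {a : ι → ℚ} {F : (ι → ℤ) → 𝕜} {γ : ι → ℤ} (h : partialTransform N E a F γ ≠ 0) :
    ∃ β : ι → ℤ, F β ≠ 0 ∧ ∀ i, (γ i : ℚ) =
      ((fun k => (β k : ℚ)) ᵥ* N) i - if i ∈ E then (a ᵥ* N) i else 0 := by
  by_contra! hcon
  refine h (finsum_eq_zero_of_forall_eq_zero fun β => ?_)
  rw [finsum_eq_if]
  split_ifs with hβ
  · by_contra h0
    obtain ⟨i, hi⟩ := hcon β h0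
    exact hi (hβ i)
  · rfl

theorem partialTransform_eq [Semiring 𝕜] {N : Matrix ι ι ℚ} (hN : IsUnit N.det) {E : Finset ι}
    {a : ι → ℚ} {F : (ι → ℤ) → 𝕜} {γ β : ι → ℤ} (h : ∀ i, (γ i : ℚ) =
      ((fun k => (β k : ℚ)) ᵥ* N) i - if i ∈ E then (a ᵥ* N) i else 0) :
    partialTransform N E a F γ = F β := by
  rw [partialTransform, finsum_eq_single _ β]
  · rw [finsum_eq_if, if_pos h]
  · intro β' hne
    rw [finsum_eq_if, if_neg]
    refine fun hβ' => hne ?_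
    have heq : (fun k => (β' k : ℚ)) ᵥ* N = (fun k => (β k : ℚ)) ᵥ* N := by
      ext i
      have := (hβ' i).symm.trans (h i)
      linarith
    have := Matrix.vecMul_injective_iff_isUnit.2 ((Matrix.isUnit_iff_isUnit_det N).2 hN) heq
    ext k
    exact_mod_cast congrFun this k

end Transforms

/-! ### Coefficients of localizations. -/

section Localization

variable {ι 𝕜 : Type*} [Fintype ι] [NormedField 𝕜]

theorem coeff_localize (s : ι → 𝕜) (q : (ι → ℤ) → 𝕜) (m : ι →₀ ℕ) :
    MvPowerSeries.coeff m (localize s q) = ∑' γ : ι → ℤ,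
      q γ * ∏ i, ((Ring.choose (γ i) (m i) : ℤ) : 𝕜) * s i ^ (γ i - (m i : ℤ)) := rfl

/-- A term of a partial transform that contributes to a coefficient of the localization has the
exceptional exponents of this coefficient. -/
theorem eq_of_localize_term_ne_zero {E : Finset ι} {s : ι → 𝕜} (hs : ∀ i ∈ E, s i = 0)
    {γ : ι → ℤ} {m : ι →₀ ℕ}
    (h : ∏ i, ((Ring.choose (γ i) (m i) : ℤ) : 𝕜) * s i ^ (γ i - (m i : ℤ)) ≠ 0) {i : ι}
    (hi : i ∈ E) : γ i = m i := by
  by_contra hne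
  refine h (Finset.prod_eq_zero (Finset.mem_univ i) ?_)
  rw [hs i hi, _root_.zero_zpow _ (sub_ne_zero.2 hne), mul_zero]

theorem exists_of_coeff_localize_ne_zero {s : ι → 𝕜} {q : (ι → ℤ) → 𝕜} {m : ι →₀ ℕ}
    (h : MvPowerSeries.coeff m (localize s q) ≠ 0) :
    ∃ γ, q γ ≠ 0 ∧
      ∏ i, ((Ring.choose (γ i) (m i) : ℤ) : 𝕜) * s i ^ (γ i - (m i : ℤ)) ≠ 0 := by
  rw [coeff_localize] at h
  by_contra! hcon
  refine h ((tsum_congr fun γ => ?_).trans tsum_zero)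
  by_cases hq : q γ = 0
  · rw [hq, zero_mul]
  · rw [hcon γ hq, mul_zero]

end Localization

end MonomialResolution

namespace MonomialResolution

/-! ### The Tschirnhausen argument on an axis. -/

section Axis

variable {ι 𝕜 : Type*} [Fintype ι] [DecidableEq ι] [NormedField 𝕜]

/-- If the exponents of `x_τ` on the exceptional face are at most `d`, and do not include `d - 1`
when they include `d`, then the localization at a point with `s τ ≠ 0` vanishes on the axis of `x_τ`
to an order less than `d`, or identically. -/
theorem exists_coeff_localize_single_ne_zero_lt [CharZero 𝕜] {E : Finset ι} {s : ι → 𝕜}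
    {q : (ι → ℤ) → 𝕜} {τ : ι} {d : ℕ} (hs : ∀ i ∈ E, s i = 0) (hτ : τ ∉ E) (hsτ : s τ ≠ 0)
    (hd : 0 < d)
    (hle : ∀ γ, q γ ≠ 0 → (∀ i ∈ E, γ i = 0) → 0 ≤ γ τ ∧ γ τ ≤ d)
    (hgap : ∀ γ, q γ ≠ 0 → (∀ i ∈ E, γ i = 0) → γ τ = d →
      ∀ γ', q γ' ≠ 0 → (∀ i ∈ E, γ' i = 0) → γ' τ = d ∨ γ' τ + 2 ≤ d)
    (hreg : ∃ k, MvPowerSeries.coeff (Finsupp.single τ k) (localize s q) ≠ 0) :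
    ∃ k < d, MvPowerSeries.coeff (Finsupp.single τ k) (localize s q) ≠ 0 := by
  obtain ⟨k, hk⟩ := hreg
  have hface : ∀ (k : ℕ) (γ : ι → ℤ), ∏ i, ((Ring.choose (γ i) (Finsupp.single τ k i) : ℤ) : 𝕜) *
      s i ^ (γ i - (Finsupp.single τ k i : ℤ)) ≠ 0 →
      (∀ i ∈ E, γ i = 0) ∧ Ring.choose (γ τ) k ≠ 0 := by
    intro k γ hγ
    refine ⟨fun i hi => ?_, fun h0 => hγ (Finset.prod_eq_zero (Finset.mem_univ τ) ?_)⟩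
    · have hne : τ ≠ i := fun h => hτ (h ▸ hi)
      simpa [hne] using eq_of_localize_term_ne_zero hs hγ hi
    · simp [h0]
  have hge : ∀ (k : ℕ) (γ : ι → ℤ), q γ ≠ 0 → (∀ i ∈ E, γ i = 0) → Ring.choose (γ τ) k ≠ 0 →
      (k : ℤ) ≤ γ τ := by
    intro k γ hγ hE hch
    obtain ⟨m, hm⟩ := Int.eq_ofNat_of_zero_le (hle γ hγ hE).1
    rw [hm, Ring.choose_natCast] at hch
    rw [hm]
    by_contra! hlt
    exact hch (by rw [Nat.choose_eq_zero_of_lt (by exact_mod_cast hlt), Nat.cast_zero])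
  rcases lt_or_ge k d with hkd | hkd
  · exact ⟨k, hkd, hk⟩
  -- A coefficient of order `k ≥ d` needs a face term with `k ≤ γ₀ τ ≤ d`; hence `k = d` and the gap
  -- hypothesis applies.
  obtain ⟨γ₀, hγ₀, hprod₀⟩ := exists_of_coeff_localize_ne_zero hk
  obtain ⟨hE₀, hch₀⟩ := hface k γ₀ hprod₀
  have h1 := hge k γ₀ hγ₀ hE₀ hch₀
  have h2 := (hle γ₀ hγ₀ hE₀).2
  have hkd' : k = d := by omega
  have hτd : γ₀ τ = d := by omega
  subst hkd'
  refine ⟨k - 1, by omega, ?_⟩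
  -- The identity holds term by term. For `γ τ = k` the factors at `τ` are `k * s τ` and `1`; for `γ
  -- τ ≤ k - 2` both binomials vanish; off the exceptional face both products vanish.
  have key : MvPowerSeries.coeff (Finsupp.single τ (k - 1)) (localize s q) =
      ((k : 𝕜) * s τ) * MvPowerSeries.coeff (Finsupp.single τ k) (localize s q) := by
    rw [coeff_localize, coeff_localize, ← tsum_mul_left]
    refine tsum_congr fun γ => ?_
    by_cases hq : q γ = 0
    · simp [hq]
    by_cases hE : ∀ i ∈ E, γ i = 0
    · rw [← Finset.mul_prod_erase _ _ (Finset.mem_univ τ),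
        ← Finset.mul_prod_erase _ _ (Finset.mem_univ τ)]
      have hrest : ∏ i ∈ Finset.univ.erase τ,
          ((Ring.choose (γ i) (Finsupp.single τ (k - 1) i) : ℤ) : 𝕜) *
            s i ^ (γ i - (Finsupp.single τ (k - 1) i : ℤ)) =
          ∏ i ∈ Finset.univ.erase τ, ((Ring.choose (γ i) (Finsupp.single τ k i) : ℤ) : 𝕜) *
            s i ^ (γ i - (Finsupp.single τ k i : ℤ)) := by
        refine Finset.prod_congr rfl fun i hi => ?_
        have := Finset.ne_of_mem_erase hi
        simp [this.symm]
      rw [hrest]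
      simp only [Finsupp.single_eq_same]
      rcases hgap γ₀ hγ₀ hE₀ hτd γ hq hE with h | h
      · rw [h, Ring.choose_natCast, Ring.choose_natCast, Nat.choose_self]
        obtain ⟨m, rfl⟩ : ∃ m, k = m + 1 := ⟨k - 1, by omega⟩
        rw [Nat.add_sub_cancel, Nat.choose_succ_self_right, sub_self, zpow_zero]
        have : ((m + 1 : ℕ) : ℤ) - (m : ℤ) = 1 := by push_cast; ring
        rw [this, zpow_one]
        push_cast
        ring
      · have hz : ∀ j : ℕ, k - 1 ≤ j → Ring.choose (γ τ) j = 0 := by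
          intro j hj
          by_contra h0
          have := hge j γ hq hE h0
          omega
        rw [hz _ le_rfl, hz k (by omega)]
        simp
    · have hz : ∀ j : ℕ, ∏ i, ((Ring.choose (γ i) (Finsupp.single τ j i) : ℤ) : 𝕜) *
          s i ^ (γ i - (Finsupp.single τ j i : ℤ)) = 0 := by
        intro j
        by_contra h0
        exact hE (hface j γ h0).1
      rw [hz, hz]
      simp
  rw [key]
  refine mul_ne_zero (mul_ne_zero ?_ hsτ) hk
  exact_mod_cast hd.ne'

end Axis

/-! ### Exponents before and after a localized reduced transform. -/

section ReducedTransform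

variable {ι 𝕜 : Type*} [Fintype ι] [DecidableEq ι] [NormedField 𝕜]

theorem exists_of_reducedTransform_ne_zero {f : MvPowerSeries ι 𝕜} {a : ι →₀ ℕ}
    {M : Matrix ι ι ℕ} {E : Finset ι} {γ : ι → ℤ} (h : reducedTransform f a M E γ ≠ 0) :
    ∃ β : ι →₀ ℕ, MvPowerSeries.coeff β f ≠ 0 ∧
      (∀ i ∈ E, γ i + ((∑ k, a k * M k i : ℕ) : ℤ) = ((∑ k, β k * M k i : ℕ) : ℤ)) ∧
      ∀ i ∉ E, γ i = β i := by
  obtain ⟨β', hβ', hγ⟩ := exists_of_partialTransform_ne_zero h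
  obtain ⟨β, hβ, hne⟩ := exists_of_ofPowerSeries_ne_zero hβ'
  have hvec : (fun k => (β' k : ℚ)) = ratVec β := by
    ext k
    simp [hβ, ratVec]
  rw [hvec] at hγ
  refine ⟨β, hne, fun i hi => ?_, fun i hi => ?_⟩
  · have := hγ i
    rw [if_pos hi, ratVec_vecMul_canonicalReduction_of_mem _ _ hi,
      ratVec_vecMul_canonicalReduction_of_mem _ _ hi, eq_sub_iff_add_eq] at this
    exact_mod_cast this
  · have := hγ i
    rw [if_neg hi, vecMul_canonicalReduction_of_notMem _ _ hi, sub_zero, ratVec] at this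
    exact_mod_cast this

/-- Exceptional coordinates of `s` are zero, so their exponents survive exactly; elsewhere the
binomial of `β i` over `α i` forces `α i ≤ β i`. -/
theorem exists_of_coeff_localize_reducedTransform_ne_zero {f : MvPowerSeries ι 𝕜} {a : ι →₀ ℕ}
    {M : Matrix ι ι ℕ} {E : Finset ι} {s : ι → 𝕜} (hs : ∀ i ∈ E, s i = 0) {α : ι →₀ ℕ}
    (h : MvPowerSeries.coeff α (localize s (reducedTransform f a M E)) ≠ 0) :
    ∃ β : ι →₀ ℕ, MvPowerSeries.coeff β f ≠ 0 ∧
      (∀ i ∈ E, α i + ∑ k, a k * M k i = ∑ k, β k * M k i) ∧ ∀ i ∉ E, α i ≤ β i := by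
  obtain ⟨γ, hγ, hprod⟩ := exists_of_coeff_localize_ne_zero h
  obtain ⟨β, hβ, hE, hE'⟩ := exists_of_reducedTransform_ne_zero hγ
  refine ⟨β, hβ, fun i hi => ?_, fun i hi => ?_⟩
  · have := hE i hi
    rw [eq_of_localize_term_ne_zero hs hprod hi] at this
    exact_mod_cast this
  · have := (Finset.prod_ne_zero_iff.1 hprod) i (Finset.mem_univ i)
    rw [hE' i hi, Ring.choose_natCast] at this
    by_contra! hlt
    rw [Nat.choose_eq_zero_of_lt hlt] at this
    simp at this

/-- The coefficient of a monomial in the exceptional variables that arises from a single monomial. -/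
theorem coeff_localize_reducedTransform_of_unique {f : MvPowerSeries ι 𝕜} {a : ι →₀ ℕ}
    {M : Matrix ι ι ℕ} {E : Finset ι} (hM : NonDegenerate (ratMatrix M) E) {s : ι → 𝕜}
    (hs : ∀ i ∈ E, s i = 0) {β ε : ι →₀ ℕ} (hβ : ∀ i ∉ E, β i = 0) (hε : ∀ i ∉ E, ε i = 0)
    (hβε : ∀ i ∈ E, ε i + ∑ k, a k * M k i = ∑ k, β k * M k i)
    (huniq : ∀ β' : ι →₀ ℕ, MvPowerSeries.coeff β' f ≠ 0 →
      (∀ i ∈ E, ε i + ∑ k, a k * M k i = ∑ k, β' k * M k i) → β' = β) :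
    MvPowerSeries.coeff ε (localize s (reducedTransform f a M E)) = MvPowerSeries.coeff β f := by
  rw [coeff_localize, tsum_eq_single (fun i => (ε i : ℤ))]
  · rw [Finset.prod_eq_one (fun i _ => by simp [Ring.choose_natCast]), mul_one, reducedTransform,
      partialTransform_eq (det_canonicalReduction_ne_zero hM).isUnit (β := fun i => (β i : ℤ)),
      ofPowerSeries_natCast]
    intro i
    have hvec : (fun k => (((β k : ℕ) : ℤ) : ℚ)) = ratVec β := by
      ext k
      simp [ratVec]
    rw [hvec]
    by_cases hi : i ∈ E
    · rw [if_pos hi, ratVec_vecMul_canonicalReduction_of_mem _ _ hi,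
        ratVec_vecMul_canonicalReduction_of_mem _ _ hi, eq_sub_iff_add_eq, ← hβε i hi]
      push_cast
      ring
    · rw [if_neg hi, vecMul_canonicalReduction_of_notMem _ _ hi, sub_zero]
      simp [hε i hi, ratVec, hβ i hi]
  · intro γ hne
    by_contra h0
    obtain ⟨β', hβ', hE, hE'⟩ := exists_of_reducedTransform_ne_zero (left_ne_zero_of_mul h0)
    have hγ : ∀ i ∈ E, γ i = ε i := fun i hi =>
      eq_of_localize_term_ne_zero hs (right_ne_zero_of_mul h0) hi
    have : β' = β := huniq β' hβ' fun i hi => by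
      have := hE i hi
      rw [hγ i hi] at this
      exact_mod_cast this
    refine hne (funext fun i => ?_)
    by_cases hi : i ∈ E
    · exact hγ i hi
    · rw [hE' i hi, this, hβ i hi, hε i hi]

end ReducedTransform

/-! ### Latent components through one resolution step. -/

section Step

variable {ι 𝕜 : Type*} [Fintype ι] [DecidableEq ι] [NormedField 𝕜]
  {T : Matrix ι ι ℚ} {L : Finset ι} {ℓ : ι → ι} {f : MvPowerSeries ι 𝕜} {p : ι} {a : ι →₀ ℕ}
  {M : Matrix ι ι ℕ} {E : Finset ι} {s : ι → 𝕜} {f' : MvPowerSeries ι 𝕜} {p' : ι} {d' : ℕ}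

theorem isUnit_det_synthetic (hT : IsUnit T.det) (hM : NonDegenerate (ratMatrix M) E) :
    IsUnit (synthetic T M E).det := by
  rw [synthetic, det_mul]
  exact hT.mul (det_canonicalReduction_ne_zero hM).isUnit

namespace IsInconsistentStep

theorem inv_apply_eq_zero (H : IsInconsistentStep T L ℓ f p a M E s f' p' d')
    (hT : IsUnit T.det) : ∀ k ∈ L, ∀ i ∉ E, (interimT (synthetic T M E) E L ℓ)⁻¹ i k = 0 := by
  intro k hk i hi
  rw [interimT_inv_apply_of_mem H.decomposition i hk]
  exact inv_apply_eq_zero_of_not_consistent (isUnit_det_synthetic hT H.nonDegenerate)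
    (H.latent k hk).2 hi

/-- The latent components after the step are differences of components before it. -/
theorem syntheticComponents_eq (H : IsInconsistentStep T L ℓ f p a M E s f' p' d')
    (hT : IsUnit T.det) {α β : ι →₀ ℕ}
    (h : ∀ i ∈ E, α i + ∑ k, a k * M k i = ∑ k, β k * M k i) {k : ι} (hk : k ∈ L) :
    syntheticComponents (interimT (synthetic T M E) E L ℓ) α k =
      syntheticComponents T β (ℓ k) - syntheticComponents T a (ℓ k) := by
  set N := canonicalReduction (ratMatrix M) E with hN
  set c : ι → ℚ := fun i => (interimT (synthetic T M E) E L ℓ)⁻¹ i k with hc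
  have hcE : ∀ i ∉ E, c i = 0 := H.inv_apply_eq_zero hT k hk
  -- The synthetic matrix is `T * N`, so `N` turns a column of its inverse into the same column of
  -- `T⁻¹`.
  have hNc : N *ᵥ c = fun i => T⁻¹ i (ℓ k) := by
    have hc' : c = fun i => (N⁻¹ * T⁻¹) i (ℓ k) := by
      ext i
      rw [hc]
      simp only
      rw [interimT_inv_apply_of_mem H.decomposition i hk, synthetic, Matrix.mul_inv_rev]
    ext i
    have : (N * (N⁻¹ * T⁻¹)) i (ℓ k) = T⁻¹ i (ℓ k) := by
      rw [← Matrix.mul_assoc, Matrix.mul_nonsing_inv _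
        (det_canonicalReduction_ne_zero H.nonDegenerate).isUnit, Matrix.one_mul]
    rw [← this, hc']
    rfl
  -- `α` need agree with `(β - a) ᵥ* N` only on `E`, since `c` vanishes elsewhere.
  have hα : ratVec α ⬝ᵥ c = (ratVec β - ratVec a) ᵥ* N ⬝ᵥ c := by
    refine Finset.sum_congr rfl fun i _ => ?_
    by_cases hi : i ∈ E
    · rw [sub_vecMul, Pi.sub_apply, ratVec_vecMul_canonicalReduction_of_mem _ _ hi,
        ratVec_vecMul_canonicalReduction_of_mem _ _ hi, ← h i hi]
      congr 1
      simp [ratVec]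
    · rw [hcE i hi, mul_zero, mul_zero]
  rw [← dotProduct_mulVec, hNc, sub_dotProduct] at hα
  exact hα

/-- Every term of the apex form comes from a term of the previous one. -/
theorem exists_of_coeff_ne_zero (H : IsInconsistentStep T L ℓ f p a M E s f' p' d')
    (hT : IsUnit T.det) {α : ι →₀ ℕ} (hα : MvPowerSeries.coeff α f' ≠ 0) :
    ∃ β, MvPowerSeries.coeff β f ≠ 0 ∧
      (∀ k ∈ L, syntheticComponents (interimT (synthetic T M E) E L ℓ) α k =
        syntheticComponents T β (ℓ k) - syntheticComponents T a (ℓ k)) ∧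
      ∀ i ∈ E, ∑ k, β k * M k i ≤ α i + ∑ k, a k * M k i := by
  obtain ⟨α', hα', hL, hle⟩ := H.reduction.exists_of_coeff_ne_zero (H.inv_apply_eq_zero hT)
    H.primary'_notMem hα
  obtain ⟨β, hβ, hE, -⟩ :=
    exists_of_coeff_localize_reducedTransform_ne_zero H.branch.exceptional hα'
  refine ⟨β, hβ, fun k hk => ?_, fun i hi => ?_⟩
  · rw [← H.syntheticComponents_eq hT hE hk]
    exact (congrFun hL ⟨k, hk⟩).symm
  · rw [← hE i hi]
    exact Nat.add_le_add_right (hle i hi) _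

/-- A monomial in the exceptional rows which is the only one with its latent components persists. -/
theorem exists_coeff_ne_zero_of_unique (H : IsInconsistentStep T L ℓ f p a M E s f' p' d')
    (hT : IsUnit T.det) {β : ι →₀ ℕ} (hβ : MvPowerSeries.coeff β f ≠ 0) (hβE : ∀ i ∉ E, β i = 0)
    (huniq : ∀ β', MvPowerSeries.coeff β' f ≠ 0 →
      (∀ k ∈ L, syntheticComponents T β' (ℓ k) = syntheticComponents T β (ℓ k)) → β' = β) :
    ∃ ε : ι →₀ ℕ, MvPowerSeries.coeff ε f' ≠ 0 ∧ (∀ i ∉ E, ε i = 0) ∧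
      ∀ i ∈ E, ε i + ∑ k, a k * M k i = ∑ k, β k * M k i := by
  -- The exponent of the transformed monomial; the natural subtraction does not truncate, by
  -- minimality at the vertex.
  let ε : ι →₀ ℕ := Finsupp.equivFunOnFinite.symm fun i =>
    if i ∈ E then ∑ k, β k * M k i - ∑ k, a k * M k i else 0
  have hεE : ∀ i ∉ E, ε i = 0 := fun i hi => by simp [ε, hi]
  have hε : ∀ i ∈ E, ε i + ∑ k, a k * M k i = ∑ k, β k * M k i := fun i hi => by
    have := H.exponential.sum_le hβ i
    simp only [ε, Finsupp.equivFunOnFinite_symm_apply_apply, if_pos hi]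
    omega
  refine ⟨ε, ?_, hεE, hε⟩
  have huniq' : ∀ (α β' : ι →₀ ℕ), MvPowerSeries.coeff β' f ≠ 0 →
      (∀ i ∈ E, α i + ∑ k, a k * M k i = ∑ k, β' k * M k i) →
      latentComponents (interimT (synthetic T M E) E L ℓ) L α =
        latentComponents (interimT (synthetic T M E) E L ℓ) L ε → β' = β := by
    intro α β' hβ' hE hL
    refine huniq β' hβ' fun k hk => ?_
    have h1 := H.syntheticComponents_eq hT hE hk
    have h2 := H.syntheticComponents_eq hT hε hk
    have h3 : syntheticComponents (interimT (synthetic T M E) E L ℓ) α k =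
      syntheticComponents (interimT (synthetic T M E) E L ℓ) ε k := congrFun hL ⟨k, hk⟩
    linarith
  refine H.reduction.coeff_ne_zero_of_isolated (H.inv_apply_eq_zero hT) H.primary'_notMem hεE
    ⟨?_, fun α hα hL => ?_⟩
  · rw [coeff_localize_reducedTransform_of_unique H.nonDegenerate H.branch.exceptional hβE hεE hε
      fun β' hβ' hE => huniq' ε β' hβ' hE rfl]
    exact hβ
  · obtain ⟨β', hβ', hE, hE'⟩ :=
      exists_of_coeff_localize_reducedTransform_ne_zero H.branch.exceptional hα
    have := huniq' α β' hβ' hE hL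
    subst this
    ext i
    by_cases hi : i ∈ E
    · have := hE i hi
      have := hε i hi
      omega
    · rw [hεE i hi]
      have := hE' i hi
      rw [hβE i hi] at this
      omega

end IsInconsistentStep

/-- On exceptional columns the interim matrix cancels its inverse, and both the offset and the
relabelling drop out. Only non-exceptional exponents see the synthetic components. -/
theorem exists_of_syntheticTransform_ne_zero {b : ι → ℚ} {σ : Equiv.Perm ι}
    (hT : IsUnit T.det) {γ : ι → ℤ}
    (h : syntheticTransform T b σ (synthetic T M E) E a f γ ≠ 0) :
    ∃ α, MvPowerSeries.coeff α f ≠ 0 ∧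
      (∀ i ∈ E, γ i + ((∑ k, a k * M k i : ℕ) : ℤ) = ((∑ k, α k * M k i : ℕ) : ℤ)) ∧
      ∀ i ∉ E, (γ i : ℚ) = b (σ i) + syntheticComponents T α (σ i) := by
  obtain ⟨β, hβ, hγ⟩ := exists_of_partialTransform_ne_zero h
  obtain ⟨α, hα, hne⟩ : ∃ α : ι →₀ ℕ, (∀ i, (β i : ℚ) = syntheticExponent T b α (σ i)) ∧
      MvPowerSeries.coeff α f ≠ 0 := by
    classical
    by_contra! hcon
    refine hβ (finsum_eq_zero_of_forall_eq_zero fun α => ?_)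
    rw [finsum_eq_if]
    split_ifs with hα
    exacts [hcon α hα, rfl]
  refine ⟨α, hne, fun i hi => ?_, fun i hi => ?_⟩
  -- Exceptional columns pair over all rows, so permuting the rows together with the exponent
  -- changes nothing.
  · have hrow : ∀ x : ι → ℚ, ((fun k => x (σ k)) ᵥ* canonicalReduction
        ((synthetic T M E).submatrix σ id) E) i = (x ᵥ* synthetic T M E) i := by
      intro x
      simp only [vecMul, dotProduct, canonicalReduction, of_apply, if_pos hi, submatrix_apply, id]
      exact Equiv.sum_comp σ fun k => x k * synthetic T M E k i
    have hlin : ∀ α : ι →₀ ℕ, (syntheticExponent T b α ᵥ* synthetic T M E) i =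
        (b ᵥ* synthetic T M E) i + ((∑ k, α k * M k i : ℕ) : ℚ) := by
      intro α
      rw [syntheticExponent, add_vecMul, Pi.add_apply,
        ← ratVec_vecMul_canonicalReduction_of_mem _ _ hi, vecMul_vecMul, synthetic,
        ← Matrix.mul_assoc, Matrix.nonsing_inv_mul _ hT, Matrix.one_mul]
    have := hγ i
    rw [if_pos hi, funext hα, hrow, hrow, hlin, hlin, add_sub_add_left_eq_sub,
      eq_sub_iff_add_eq] at this
    exact_mod_cast this
  · have := hγ i
    rw [if_neg hi, vecMul_canonicalReduction_of_notMem _ _ hi, sub_zero, hα] at this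
    exact this

end Step

end MonomialResolution

/-! ### The order drop in nesting degree two. -/

open MonomialResolution in
/-- Labels in nesting degree two: `p` is the label of `x₁`, `p₁` that of `x'₁`, `e` that of the latent
primary variable `x̄₁` after the second step, `p₂` that of `x''₁`, and `τ` that of `t''₁`. -/
theorem mainTheorem10 {ι 𝕜 : Type*} [Fintype ι] [DecidableEq ι]
    [NormedField 𝕜] [CompleteSpace 𝕜] [CharZero 𝕜]
    -- the Weierstrass polynomial `w` with primary variable `x₁` and height `d`
    (w : MvPowerSeries ι 𝕜) (p : ι) (d : ℕ) (hd : 1 < d)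
    (hw : IsWeierstrassPolynomial p d w) (hwd : w.order = (d : ℕ∞))
    -- first step: `x₁` becomes latent, and the apex form `f₁` has height `d₁`
    (a₀ : ι →₀ ℕ) (M₀ : Matrix ι ι ℕ) (E₀ : Finset ι) (s₀ : ι → 𝕜)
    (f₁ : MvPowerSeries ι 𝕜) (p₁ : ι) (d₁ : ℕ)
    (step₁ : IsInconsistentStep 1 {p} id w p a₀ M₀ E₀ s₀ f₁ p₁ d₁)
    (T₁ : Matrix ι ι ℚ) (hT₁ : T₁ = interimT (synthetic 1 M₀ E₀) E₀ {p} id)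
    (b₁ : ι → ℚ) (hb₁ : b₁ = nextOffset 1 0 M₀ a₀ E₀ {p} id)
    -- second step: `x'₁` becomes latent and `x₁` sustains its latency (nesting degree two)
    (e : ι) (he : e ≠ p₁) (ℓ : ι → ι) (hℓ : ℓ = fun j => if j = e then p else j)
    (a₁ : ι →₀ ℕ) (M₁ : Matrix ι ι ℕ) (E₁ : Finset ι) (s₁ : ι → 𝕜)
    (f₂ : MvPowerSeries ι 𝕜) (p₂ : ι) (d₂ : ℕ)
    (step₂ : IsInconsistentStep T₁ {e, p₁} ℓ f₁ p₁ a₁ M₁ E₁ s₁ f₂ p₂ d₂)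
    (T₂ : Matrix ι ι ℚ) (hT₂ : T₂ = interimT (synthetic T₁ M₁ E₁) E₁ {e, p₁} ℓ)
    (b₂ : ι → ℚ) (hb₂ : b₂ = nextOffset T₁ b₁ M₁ a₁ E₁ {e, p₁} ℓ)
    -- third step: the synthetic matrix `Q₂`, whether `x''₁` is consistent or inconsistent
    (a₂ : ι →₀ ℕ) (M₂ : Matrix ι ι ℕ) (E₂ : Finset ι)
    (hM₂ : IsExponentialMatrix f₂ a₂ M₂) (hD₂ : NonDegenerate (ratMatrix M₂) E₂)
    (hp₂ : p₂ ∈ E₂ ↔ ¬ Consistent (ratMatrix M₂) p₂ E₂)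
    (Q₂ : Matrix ι ι ℚ) (hQ₂ : Q₂ = synthetic T₂ M₂ E₂)
    -- `x̄₁` is inconsistent with `Q₂`, whereas `x'₁` is consistent and revived as `t''₁`
    (hinc : ¬ Consistent Q₂ e E₂) (hcons : Consistent Q₂ p₁ E₂)
    (σ : Equiv.Perm ι) (hσ : NonDegenerate (Q₂.submatrix σ id) E₂)
    (τ : ι) (hτ : σ τ = p₁) (hτE : τ ∉ E₂)
    -- a regular reduced branch point
    (s₂ : ι → 𝕜)
    (hs₂ : IsReducedBranchPoint E₂ (syntheticTransform T₂ b₂ σ Q₂ E₂ a₂ f₂) s₂)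
    (hreg : IsRegular E₂ (syntheticTransform T₂ b₂ σ Q₂ E₂ a₂ f₂) s₂ τ) :
    (proper E₂ (localize s₂ (syntheticTransform T₂ b₂ σ Q₂ E₂ a₂ f₂))).order < (d₁ : ℕ∞) ∧
      (localize s₂ (syntheticTransform T₂ b₂ σ Q₂ E₂ a₂ f₂)).order < (d₁ : ℕ∞) := by
  classical
  have hpE₀ : p ∈ E₀ := step₁.primary_mem
  have hp₁E₀ : p₁ ∉ E₀ := step₁.primary'_notMem
  have hp₁E₁ : p₁ ∈ E₁ := step₂.primary_mem
  have hℓe : ℓ e = p := by simp [hℓ]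
  have hℓp₁ : ℓ p₁ = p₁ := by simp [hℓ, he.symm]
  have hp₁p : p₁ ≠ p := fun h => hp₁E₀ (h ▸ hpE₀)
  have hQ₀ := isUnit_det_synthetic (T := (1 : Matrix ι ι ℚ)) (by simp) step₁.nonDegenerate
  have hU₁ : IsUnit T₁.det := hT₁ ▸ isUnit_det_interimT step₁.decomposition hQ₀
  have hQ₁ := isUnit_det_synthetic hU₁ step₂.nonDegenerate
  have hU₂ : IsUnit T₂.det := hT₂ ▸ isUnit_det_interimT step₂.decomposition hQ₁
  have hQ₂U : IsUnit Q₂.det := hQ₂ ▸ isUnit_det_synthetic hU₂ hD₂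
  -- the exponents of `x'₁` are not changed by the first interim matrix
  have hcol : ∀ α : ι →₀ ℕ, syntheticComponents T₁ α p₁ = α p₁ := by
    intro α
    rw [syntheticComponents_apply, hT₁]
    simp_rw [interimT_inv_apply_of_notMem step₁.decomposition hQ₀ _
      (show p₁ ∉ ({p} : Finset ι) by simpa using hp₁p) hp₁E₀]
    simp [Matrix.one_apply]
  -- This offset cancels the translation by the vertex in the second step, so that `t''₁` regains
  -- the exponent of `x'₁` in `f₁`.
  have hb₂p₁ : b₂ p₁ = a₁ p₁ := by
    have hb₁p₁ : b₁ p₁ = 0 := by simp [hb₁, nextOffset, hp₁E₀]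
    have : b₂ p₁ = syntheticExponent T₁ b₁ a₁ p₁ := by
      simp [hb₂, nextOffset, hp₁E₁, vecMul, dotProduct, interimS, hℓp₁]
    rw [this, syntheticExponent, Pi.add_apply, hb₁p₁, zero_add]
    exact hcol a₁
  -- the Weierstrass polynomial produced by the first step
  have hW := step₁.reduction
  obtain ⟨-, -, -, -, -, -, -, hW₁, hW₂⟩ := hW
  have hcoeff : ∀ α, MvPowerSeries.coeff α (latentReducible T₁ {p} f₁) =
      if LatentZero T₁ {p} α then MvPowerSeries.coeff α f₁ else 0 := fun _ => rfl
  have hzero : ∀ α, LatentZero T₁ {p} α ↔ syntheticComponents T₁ α p = 0 := by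
    intro α
    simp only [LatentZero, Finset.mem_singleton, forall_eq]
    rfl
  rw [← hT₁] at hW₁ hW₂
  simp only [hcoeff, hzero] at hW₁ hW₂
  set ζ : ι →₀ ℕ := Finsupp.single p₁ d₁ with hζdef
  have hζ0 : syntheticComponents T₁ ζ p = 0 := by
    by_contra h
    simp [h] at hW₁
  have hζ : MvPowerSeries.coeff ζ f₁ ≠ 0 := by
    rw [if_pos hζ0] at hW₁
    simp [hW₁]
  have hζp₁ : ζ p₁ = d₁ := by simp [hζdef]
  have hW' : ∀ α, MvPowerSeries.coeff α f₁ ≠ 0 → syntheticComponents T₁ α p = 0 →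
      α = ζ ∨ α p₁ + 2 ≤ d₁ := by
    intro α hα h0
    rcases hW₂ α (by rwa [if_pos h0]) with h | h
    exacts [Or.inl h, Or.inr h.1]
  -- Height zero would mean a nonzero constant term of the proper transform, contrary to the branch
  -- point being a zero.
  have hd₁ : 0 < d₁ := by
    rcases Nat.eq_zero_or_pos d₁ with h0 | h0
    · have hh := step₁.height
      rw [h0, Nat.cast_zero, ← Nat.cast_zero, MvPowerSeries.order_eq_nat] at hh
      obtain ⟨⟨δ, hδ, hδ0⟩, -⟩ := hh
      rw [Finsupp.degree_eq_zero_iff] at hδ0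
      subst hδ0
      rw [MvPowerSeries.coeff_zero_eq_constantCoeff_apply] at hδ
      exact absurd step₁.branch.vanishes hδ
    · exact h0
  -- the monomial of `x'₁ ^ d₁` survives the second step
  obtain ⟨ε, hε, hεE, hεζ⟩ := step₂.exists_coeff_ne_zero_of_unique hU₁ hζ
    (fun i hi => by
      have : p₁ ≠ i := fun h => hi (h ▸ hp₁E₁)
      simp [hζdef, this])
    (fun β' hβ' hL => by
      have h1 := hL e (by simp)
      have h2 := hL p₁ (by simp)
      rw [hℓe, hζ0] at h1
      rw [hℓp₁, hcol, hcol, hζp₁] at h2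
      have h2' : β' p₁ = d₁ := by exact_mod_cast h2
      rcases hW' β' hβ' h1 with h | h
      · exact h
      · omega)
  have hεe := step₂.syntheticComponents_eq hU₁ hεζ (k := e) (by simp)
  rw [← hT₂, hℓe, hζ0] at hεe
  -- terms of the partial transform
  have hterm : ∀ γ, syntheticTransform T₂ b₂ σ Q₂ E₂ a₂ f₂ γ ≠ 0 → (∀ i ∈ E₂, γ i = 0) →
      ∃ α β, MvPowerSeries.coeff α f₂ ≠ 0 ∧ MvPowerSeries.coeff β f₁ ≠ 0 ∧
        γ τ = β p₁ ∧ (∀ i ∈ E₂, ∑ k, a₂ k * M₂ k i = ∑ k, α k * M₂ k i) ∧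
        (∀ i ∈ E₁, ∑ k, β k * M₁ k i ≤ α i + ∑ k, a₁ k * M₁ k i) ∧
        syntheticComponents T₂ α e =
          syntheticComponents T₁ β p - syntheticComponents T₁ a₁ p := by
    intro γ hγ hγE
    rw [hQ₂] at hγ
    obtain ⟨α, hα, hαE, hαE'⟩ := exists_of_syntheticTransform_ne_zero hU₂ hγ
    obtain ⟨β, hβ, hβL, hβE⟩ := step₂.exists_of_coeff_ne_zero hU₁ hα
    refine ⟨α, β, hα, hβ, ?_, fun i hi => ?_, hβE, ?_⟩
    · have h1 := hαE' τ hτE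
      have h2 := hβL p₁ (by simp)
      rw [← hT₂, hℓp₁, hcol, hcol] at h2
      rw [hτ, hb₂p₁, h2, add_sub_cancel] at h1
      exact_mod_cast h1
    · have := hαE i hi
      rw [hγE i hi, zero_add] at this
      exact_mod_cast this
    · have := hβL e (by simp)
      rwa [← hT₂, hℓe] at this
  -- the latent component of `x̄₁` is constant on the exceptional face
  have hconst : ∀ α : ι →₀ ℕ, (∀ i ∈ E₂, ∑ k, a₂ k * M₂ k i = ∑ k, α k * M₂ k i) →
      syntheticComponents T₂ α e = syntheticComponents T₂ a₂ e := by
    intro α hα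
    set N := canonicalReduction (ratMatrix M₂) E₂ with hN
    have hc : T₂⁻¹ = N * Q₂⁻¹ := by
      rw [hQ₂, synthetic, Matrix.mul_inv_rev, ← Matrix.mul_assoc, Matrix.mul_nonsing_inv _
        (det_canonicalReduction_ne_zero hD₂).isUnit, Matrix.one_mul]
    have hval : ∀ α : ι →₀ ℕ, syntheticComponents T₂ α e =
        ∑ i, (ratVec α ᵥ* N) i * Q₂⁻¹ i e := by
      intro α
      change (ratVec α ᵥ* T₂⁻¹) e = _
      rw [hc, ← vecMul_vecMul]
      rfl
    rw [hval, hval]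
    refine Finset.sum_congr rfl fun i _ => ?_
    by_cases hi : i ∈ E₂
    · rw [ratVec_vecMul_canonicalReduction_of_mem _ _ hi,
        ratVec_vecMul_canonicalReduction_of_mem _ _ hi, hα i hi]
    · rw [inv_apply_eq_zero_of_not_consistent hQ₂U hinc hi, mul_zero, mul_zero]
  -- if `x'₁` occurs with exponent at least `d₁`, the face lies in the latent reducible part
  have hbig : ∀ γ, syntheticTransform T₂ b₂ σ Q₂ E₂ a₂ f₂ γ ≠ 0 → (∀ i ∈ E₂, γ i = 0) →
      (d₁ : ℤ) ≤ γ τ →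
      syntheticComponents T₂ a₂ e = - syntheticComponents T₁ a₁ p := by
    intro γ hγ hγE hle
    obtain ⟨α, β, hα, hβ, hγτ, hαE, hβE, -⟩ := hterm γ hγ hγE
    have hdβ : d₁ ≤ β p₁ := by
      rw [hγτ] at hle
      exact_mod_cast hle
    -- `ζ` is a pure power of `x'₁`, so one coordinate decides divisibility.
    have hζβ : ∀ k, ζ k ≤ β k := by
      intro k
      by_cases hk : p₁ = k
      · subst hk
        rwa [hζp₁]
      · simp [hζdef, hk]
    have hεα : ∀ i, ε i ≤ α i := by
      intro i
      by_cases hi : i ∈ E₁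
      · have h1 := hεζ i hi
        have h2 := hβE i hi
        have h3 : ∑ k, ζ k * M₁ k i ≤ ∑ k, β k * M₁ k i :=
          Finset.sum_le_sum fun k _ => Nat.mul_le_mul_right _ (hζβ k)
        omega
      · simp [hεE i hi]
    -- `ε` is squeezed between the minimum attained at `a₂` and the face exponent `α`.
    have hface : ∀ i ∈ E₂, ∑ k, a₂ k * M₂ k i = ∑ k, ε k * M₂ k i := by
      intro i hi
      refine le_antisymm (hM₂.sum_le hε i) ?_
      rw [hαE i hi]
      exact Finset.sum_le_sum fun k _ => Nat.mul_le_mul_right _ (hεα k)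
    rw [← hconst ε hface, hεe, zero_sub]
  have hdich : ∀ γ, syntheticTransform T₂ b₂ σ Q₂ E₂ a₂ f₂ γ ≠ 0 → (∀ i ∈ E₂, γ i = 0) →
      (d₁ : ℤ) ≤ γ τ → ∀ γ', syntheticTransform T₂ b₂ σ Q₂ E₂ a₂ f₂ γ' ≠ 0 →
      (∀ i ∈ E₂, γ' i = 0) → γ' τ = d₁ ∨ γ' τ + 2 ≤ d₁ := by
    intro γ hγ hγE hle γ' hγ' hγE'
    have h0 := hbig γ hγ hγE hle
    obtain ⟨α, β, -, hβ, hγτ, hαE, -, hαe⟩ := hterm γ' hγ' hγE'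
    rw [hconst α hαE, h0] at hαe
    rw [hγτ]
    rcases hW' β hβ (by linarith) with h | h
    · left
      rw [h, hζp₁]
    · right
      exact_mod_cast h
  have hproper : ∀ k, MvPowerSeries.coeff (Finsupp.single τ k)
      (proper E₂ (localize s₂ (syntheticTransform T₂ b₂ σ Q₂ E₂ a₂ f₂))) =
      MvPowerSeries.coeff (Finsupp.single τ k)
        (localize s₂ (syntheticTransform T₂ b₂ σ Q₂ E₂ a₂ f₂)) := by
    intro k
    refine if_pos fun i hi => ?_
    have : τ ≠ i := fun h => hτE (h ▸ hi)
    simp [this]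
  obtain ⟨k, hkd, hk⟩ := exists_coeff_localize_single_ne_zero_lt hs₂.exceptional hτE
    (hs₂.torus τ hτE) hd₁
    (fun γ hγ hγE => by
      refine ⟨?_, ?_⟩
      · obtain ⟨α, β, -, -, hγτ, -⟩ := hterm γ hγ hγE
        rw [hγτ]
        exact Int.natCast_nonneg _
      -- The dichotomy applied to `γ` itself excludes exponents above `d₁`.
      · by_contra! hlt
        have := hdich γ hγ hγE hlt.le γ hγ hγE
        omega)
    (fun γ hγ hγE h => hdich γ hγ hγE h.ge)
    (by
      obtain ⟨k, hk⟩ := hreg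
      exact ⟨k, by rwa [hproper] at hk⟩)
  have hlt : ((Finsupp.degree (Finsupp.single τ k) : ℕ) : ℕ∞) < d₁ := by
    rw [Finsupp.degree_single]
    exact_mod_cast hkd
  exact ⟨(MvPowerSeries.order_le (by rwa [hproper])).trans_lt hlt,
    (MvPowerSeries.order_le hk).trans_lt hlt⟩
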